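/- Throughout, Banach spaces are real. For Banach spaces $X$ and $Y$, let $X\widehat{\otimes}_\pi Y$ be their projective tensor product, i.e. the completion of the algebraic tensor product $X\otimes Y$ for the norm $\|z\|_\pi=\inf\{\sum_{i=1}^n\|x_i\|\,\|y_i\| : z=\sum_{i=1}^n x_i\otimes y_i\}$. Every bounded operator $T\colon X\to Y^*$ is regarded as the element of $(X\widehat{\otimes}_\pi Y)^*$ determined by $x\otimes y\mapsto T(x)(y)$, and $K(X,Y^*)$ denotes the set of compact operators from $X$ to $Y^*$. The pair $(X,Y^*)$ has the compact approximation property (CAP) if $K(X,Y^*)$ is dense in the space $L(X,Y^*)$ of bounded operators for the topology of uniform convergence on compact subsets of $X$. Write $B_E$ for the closed unit ball of $E$; a point $x$ of a set $C\subseteq E$ is a preserved extreme point of $C$ if (the canonical image of) $x$ is an extreme point of the weak$^*$-closure of $C$ in $E^{**}$. **Corollary.** Let $X$ and $Y$ be nonzero Banach spaces such that $K(X,Y^*)$ separates the points of $X\widehat{\otimes}_\pi Y$ (in particular, this holds whenever the pair $(X,Y^*)$ has the CAP). If $z$ is a preserved extreme point of $B_{X\widehat{\otimes}_\pi Y}$,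 then $z=x\otimes y$ for some preserved extreme points $x$ of $B_X$ and $y$ of $B_Y$. -/

import Mathlib

open scoped TensorProduct

noncomputable section

namespace ProjTensor

/-- The algebraic tensor product of two real vector spaces, as a type of its own, so that it can
carry the projective norm. -/
def Alg (X Y : Type*) [AddCommGroup X] [Module ℝ X] [AddCommGroup Y] [Module ℝ Y] : Type _ :=
  X ⊗[ℝ] Y

instance (X Y : Type*) [AddCommGroup X] [Module ℝ X] [AddCommGroup Y] [Module ℝ Y] :
    AddCommGroup (Alg X Y) :=
  inferInstanceAs (AddCommGroup (X ⊗[ℝ] Y))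

instance (X Y : Type*) [AddCommGroup X] [Module ℝ X] [AddCommGroup Y] [Module ℝ Y] :
    Module ℝ (Alg X Y) :=
  inferInstanceAs (Module ℝ (X ⊗[ℝ] Y))

/-- The bilinear map sending `x` and `y` to the elementary tensor `x ⊗ y`. -/
def Alg.mk (X Y : Type*) [AddCommGroup X] [Module ℝ X] [AddCommGroup Y] [Module ℝ Y] :
    X →ₗ[ℝ] Y →ₗ[ℝ] Alg X Y :=
  TensorProduct.mk ℝ X Y

variable (X Y : Type*) [NormedAddCommGroup X] [NormedSpace ℝ X]
  [NormedAddCommGroup Y] [NormedSpace ℝ Y]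

variable {X Y} in
/-- The sums `∑ ‖x i‖ * ‖y i‖` over all the finite representations `z = ∑ x i ⊗ y i`. -/
def reprSums (z : Alg X Y) : Set ℝ :=
  {r | ∃ (n : ℕ) (x : Fin n → X) (y : Fin n → Y),
    z = ∑ i, Alg.mk X Y (x i) (y i) ∧ r = ∑ i, ‖x i‖ * ‖y i‖}

variable {X Y} in
/-- The projective norm: the infimum of `∑ ‖x i‖ * ‖y i‖` over all the finite representations
`z = ∑ x i ⊗ y i`. -/
def projNorm (z : Alg X Y) : ℝ := sInf (reprSums z)

variable {X Y}

theorem reprSums_nonneg {z : Alg X Y} {r : ℝ} (hr : r ∈ reprSums z) : 0 ≤ r := by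
  obtain ⟨n, x, y, -, rfl⟩ := hr
  positivity

theorem bddBelow_reprSums (z : Alg X Y) : BddBelow (reprSums z) :=
  ⟨0, fun _ hr => reprSums_nonneg hr⟩

theorem reprSums_zero : (0 : ℝ) ∈ reprSums (0 : Alg X Y) :=
  ⟨0, Fin.elim0, Fin.elim0, by simp, by simp⟩

theorem reprSums_mk (x : X) (y : Y) : ‖x‖ * ‖y‖ ∈ reprSums (Alg.mk X Y x y) :=
  ⟨1, fun _ => x, fun _ => y, by simp, by simp⟩

theorem reprSums_add {z w : Alg X Y} {r s : ℝ} (hr : r ∈ reprSums z) (hs : s ∈ reprSums w) :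
    r + s ∈ reprSums (z + w) := by
  obtain ⟨n, x, y, rfl, rfl⟩ := hr
  obtain ⟨m, x', y', rfl, rfl⟩ := hs
  exact ⟨n + m, Fin.append x x', Fin.append y y', by simp [Fin.sum_univ_add],
    by simp [Fin.sum_univ_add]⟩

theorem reprSums_smul (a : ℝ) {z : Alg X Y} {r : ℝ} (hr : r ∈ reprSums z) :
    |a| * r ∈ reprSums (a • z) := by
  obtain ⟨n, x, y, rfl, rfl⟩ := hr
  exact ⟨n, fun i => a • x i, y, by simp [Finset.smul_sum],
    by simp [norm_smul, Finset.mul_sum, mul_assoc]⟩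

theorem reprSums_nonempty (z : Alg X Y) : (reprSums z).Nonempty := by
  refine TensorProduct.induction_on (R := ℝ) (M := X) (N := Y)
    (motive := fun z => (reprSums (X := X) (Y := Y) z).Nonempty) z
    ⟨0, reprSums_zero⟩ (fun x y => ⟨_, reprSums_mk x y⟩) ?_
  rintro z w ⟨r, hr⟩ ⟨s, hs⟩
  exact ⟨r + s, reprSums_add hr hs⟩

theorem projNorm_le {z : Alg X Y} {r : ℝ} (hr : r ∈ reprSums z) : projNorm z ≤ r :=
  csInf_le (bddBelow_reprSums z) hr

theorem le_projNorm {z : Alg X Y} {a : ℝ} (h : ∀ r ∈ reprSums z, a ≤ r) : a ≤ projNorm z :=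
  le_csInf (reprSums_nonempty z) h

theorem projNorm_nonneg (z : Alg X Y) : 0 ≤ projNorm z :=
  le_projNorm fun _ hr => reprSums_nonneg hr

theorem projNorm_zero : projNorm (0 : Alg X Y) = 0 :=
  le_antisymm (projNorm_le reprSums_zero) (projNorm_nonneg 0)

theorem projNorm_add_le (z w : Alg X Y) : projNorm (z + w) ≤ projNorm z + projNorm w := by
  rw [← sub_le_iff_le_add]
  refine le_projNorm fun r hr => ?_
  rw [sub_le_comm]
  refine le_projNorm fun s hs => ?_
  rw [sub_le_iff_le_add']
  exact projNorm_le (reprSums_add hr hs)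

theorem projNorm_smul_le (a : ℝ) (z : Alg X Y) : projNorm (a • z) ≤ ‖a‖ * projNorm z := by
  rw [Real.norm_eq_abs, projNorm, projNorm, ← smul_eq_mul, ← Real.sInf_smul_of_nonneg (abs_nonneg a)]
  refine le_csInf ((reprSums_nonempty z).smul_set) ?_
  rintro _ ⟨r, hr, rfl⟩
  exact projNorm_le (reprSums_smul a hr)

/-- The projective norm as a seminorm. -/
def projSeminorm : Seminorm ℝ (Alg X Y) :=
  Seminorm.ofSMulLE projNorm projNorm_zero projNorm_add_le projNorm_smul_le

instance : SeminormedAddCommGroup (Alg X Y) :=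
  AddGroupSeminorm.toSeminormedAddCommGroup (projSeminorm (X := X) (Y := Y)).toAddGroupSeminorm

instance : NormedSpace ℝ (Alg X Y) := ⟨projNorm_smul_le⟩

theorem norm_def (z : Alg X Y) : ‖z‖ = projNorm z := rfl

end ProjTensor

open ProjTensor

/-- The projective tensor product `X ⊗̂_π Y`: the completion of the algebraic tensor product with
respect to the projective norm. -/
abbrev ProjectiveTensorProduct (X Y : Type*) [NormedAddCommGroup X] [NormedSpace ℝ X]
    [NormedAddCommGroup Y] [NormedSpace ℝ Y] : Type _ :=
  UniformSpace.Completion (Alg X Y)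

namespace ProjectiveTensorProduct

variable {X Y : Type*} [NormedAddCommGroup X] [NormedSpace ℝ X]
  [NormedAddCommGroup Y] [NormedSpace ℝ Y]

/-- The elementary tensor `x ⊗ y` in the projective tensor product. -/
def tmul (x : X) (y : Y) : ProjectiveTensorProduct X Y :=
  ((Alg.mk X Y x y : Alg X Y) : UniformSpace.Completion (Alg X Y))

/-- The linear functional `∑ x i ⊗ y i ↦ ∑ T (x i) (y i)` on the algebraic tensor product. -/
def algFunctional (T : X →L[ℝ] StrongDual ℝ Y) : Alg X Y →ₗ[ℝ] ℝ :=
  TensorProduct.lift (R := ℝ) (M := X) (N := Y)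
    ((ContinuousLinearMap.coeLM ℝ).comp T.toLinearMap)

theorem algFunctional_mk (T : X →L[ℝ] StrongDual ℝ Y) (x : X) (y : Y) :
    algFunctional T (Alg.mk X Y x y) = T x y :=
  TensorProduct.lift.tmul x y

theorem norm_algFunctional_le (T : X →L[ℝ] StrongDual ℝ Y) (z : Alg X Y) :
    ‖algFunctional T z‖ ≤ ‖T‖ * ‖z‖ := by
  rw [norm_def, projNorm, ← smul_eq_mul, ← Real.sInf_smul_of_nonneg (norm_nonneg T)]
  refine le_csInf ((reprSums_nonempty z).smul_set) ?_
  rintro _ ⟨_, ⟨n, x, y, rfl, rfl⟩, rfl⟩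
  simp only [map_sum, algFunctional_mk, smul_eq_mul, Finset.mul_sum]
  refine (norm_sum_le _ _).trans (Finset.sum_le_sum fun i _ => ?_)
  rw [← mul_assoc]
  exact T.le_opNorm₂ (x i) (y i)

/-- The functional on the projective tensor product given by an operator `T : X → Y*` under the
identification `(X ⊗̂_π Y)* = L(X, Y*)`: the continuous linear functional whose value at `x ⊗ y`
is `T x y`. -/
def functional (T : X →L[ℝ] StrongDual ℝ Y) : StrongDual ℝ (ProjectiveTensorProduct X Y) :=
  ((algFunctional T).mkContinuous ‖T‖ (norm_algFunctional_le T)).extend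
    (UniformSpace.Completion.toComplL : Alg X Y →L[ℝ] UniformSpace.Completion (Alg X Y))

theorem functional_tmul (T : X →L[ℝ] StrongDual ℝ Y) (x : X) (y : Y) :
    functional T (tmul x y) = T x y := by
  refine (ContinuousLinearMap.extend_eq _ ?_ ?_ _).trans (algFunctional_mk T x y)
  · exact UniformSpace.Completion.denseRange_coe
  · exact UniformSpace.Completion.isUniformInducing_coe _

end ProjectiveTensorProduct

/-- `K(X, Y*)`, viewed inside `(X ⊗̂_π Y)* = L(X, Y*)`, separates the points of `X ⊗̂_π Y`. -/
def CompactOperatorsSeparate (X Y : Type*) [NormedAddCommGroup X] [NormedSpace ℝ X]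
    [NormedAddCommGroup Y] [NormedSpace ℝ Y] : Prop :=
  Set.SeparatesPoints {f : ProjectiveTensorProduct X Y → ℝ |
    ∃ K : X →L[ℝ] StrongDual ℝ Y, IsCompactOperator K ∧ f = ProjectiveTensorProduct.functional K}

open scoped CompactConvergenceCLM in
/-- The pair `(X, Z)` has the compact approximation property: the compact operators are dense in
`L(X, Z)` for the topology of uniform convergence on the compact subsets of `X`. -/
def HasCompactApproximationProperty (X Z : Type*) [NormedAddCommGroup X] [NormedSpace ℝ X]
    [NormedAddCommGroup Z] [NormedSpace ℝ Z] : Prop :=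
  closure {K : X →L_c[ℝ] Z | IsCompactOperator K} = Set.univ

/-- The canonical embedding of `E` into its bidual with the weak-star topology. -/
def toWeakStarBidual (E : Type*) [NormedAddCommGroup E] [NormedSpace ℝ E] (x : E) :
    WeakDual ℝ (StrongDual ℝ E) :=
  StrongDual.toWeakDual (NormedSpace.inclusionInDoubleDual ℝ E x)

/-- `x ∈ C` is a preserved extreme point of `C` if it is an extreme point of the weak-star closure
of `C` in the bidual. -/
def IsPreservedExtremePoint {E : Type*} [NormedAddCommGroup E] [NormedSpace ℝ E]
    (C : Set E) (x : E) : Prop :=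
  x ∈ C ∧ toWeakStarBidual E x ∈ (closure (toWeakStarBidual E '' C)).extremePoints ℝ

end

open Filter Topology Set ProjTensor

/-- **Milman's theorem**: if a compact convex set lies in the closed convex hull of a subset, then
its extreme points belong to the closure of that subset. -/
theorem mem_closure_of_mem_extremePoints {E : Type*} [AddCommGroup E] [Module ℝ E]
    [TopologicalSpace E] [IsTopologicalAddGroup E] [ContinuousSMul ℝ E] [LocallyConvexSpace ℝ E]
    [T2Space E] {W S : Set E} (hW : IsCompact W) (hWc : Convex ℝ W) (hSW : S ⊆ W)
    (hWS : W ⊆ closure (convexHull ℝ S)) {z : E} (hz : z ∈ W.extremePoints ℝ) :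
    z ∈ closure S := by
  by_contra hzS
  have hSW' : closure S ⊆ W := closure_minimal hSW hW.isClosed
  have hsub : ∀ t : Set E, closure (convexHull ℝ (t ∩ W)) ⊆ W := fun t =>
    closure_minimal (convexHull_min inter_subset_right hWc) hW.isClosed
  have key : z ∉ closure (convexHull ℝ (closure S ∩ W)) := by
    refine (hW.of_isClosed_subset isClosed_closure hSW').induction_on
      (p := fun t => z ∉ closure (convexHull ℝ (t ∩ W))) (by simp)
      (fun s t hst ht hs => ht (closure_mono (convexHull_mono (by gcongr)) hs)) ?_ ?_
    · intro s t hs ht hst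
      rcases (s ∩ W).eq_empty_or_nonempty with h | hsn
      · rw [union_inter_distrib_right, h, empty_union] at hst
        exact ht hst
      rcases (t ∩ W).eq_empty_or_nonempty with h | htn
      · rw [union_inter_distrib_right, h, union_empty] at hst
        exact hs hst
      set A := closure (convexHull ℝ (s ∩ W))
      set B := closure (convexHull ℝ (t ∩ W))
      have hAc : IsCompact A := hW.of_isClosed_subset isClosed_closure (hsub s)
      have hBc : IsCompact B := hW.of_isClosed_subset isClosed_closure (hsub t)
      have hsA : s ∩ W ⊆ A := (subset_convexHull ℝ _).trans subset_closure
      have htB : t ∩ W ⊆ B := (subset_convexHull ℝ _).trans subset_closure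
      have hJ : IsCompact (convexJoin ℝ A B) := by
        have : convexJoin ℝ A B = (fun p : ℝ × E × E => (1 - p.1) • p.2.1 + p.1 • p.2.2) ''
            (Icc (0 : ℝ) 1 ×ˢ A ×ˢ B) := by
          ext u
          simp only [mem_convexJoin, segment_eq_image, mem_image, mem_prod, Prod.exists]
          constructor
          · rintro ⟨a, ha, b, hb, θ, hθ, rfl⟩
            exact ⟨θ, a, b, ⟨hθ, ha, hb⟩, rfl⟩
          · rintro ⟨θ, a, b, ⟨hθ, ha, hb⟩, rfl⟩
            exact ⟨a, ha, b, hb, θ, hθ, rfl⟩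
        rw [this]
        exact (isCompact_Icc.prod (hAc.prod hBc)).image (by fun_prop)
      have hzJ : z ∈ convexJoin ℝ A B := by
        refine closure_minimal (convexHull_min ?_ ?_) hJ.isClosed hst
        · rw [union_inter_distrib_right]
          exact union_subset (hsA.trans (subset_convexJoin_left (htn.mono htB)))
            (htB.trans (subset_convexJoin_right (hsn.mono hsA)))
        · exact (convex_convexHull ℝ _).closure.convexJoin (convex_convexHull ℝ _).closure
      obtain ⟨a, ha, b, hb, hab⟩ := mem_convexJoin.1 hzJ
      rw [mem_extremePoints_iff_forall_segment] at hz
      rcases hz.2 a (hsub s ha) b (hsub t hb) hab with rfl | rfl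
      · exact hs ha
      · exact ht hb
    · intro x hx
      have hxz : x ≠ z := fun h => hzS (h ▸ hx)
      obtain ⟨f, hf⟩ := geometric_hahn_banach_point_point hxz
      obtain ⟨c, hxc, hcz⟩ := exists_between hf
      refine ⟨{y | f y < c}, mem_nhdsWithin_of_mem_nhds
        ((isOpen_lt f.continuous continuous_const).mem_nhds hxc), fun h => ?_⟩
      have : z ∈ {y | f y ≤ c} := closure_minimal (convexHull_min (fun y hy => show f y ≤ c from
        le_of_lt (show f y < c from hy.1))
        (convex_halfSpace_le f.toLinearMap.isLinear c))
        (isClosed_le f.continuous continuous_const) h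
      exact absurd hcz (not_lt.2 this)
  rw [inter_eq_left.2 hSW'] at key
  exact key (closure_mono (convexHull_mono subset_closure) (hWS hz.1))

section WeakStarBidual

variable {E F : Type*} [NormedAddCommGroup E] [NormedSpace ℝ E]
  [NormedAddCommGroup F] [NormedSpace ℝ F]

/-- The canonical embedding into the bidual as a continuous linear map. -/
noncomputable def toWeakStarBidualCLM (E : Type*) [NormedAddCommGroup E] [NormedSpace ℝ E] :
    E →L[ℝ] WeakDual ℝ (StrongDual ℝ E) :=
  NormedSpace.Dual.continuousLinearMapToWeakDual.comp (NormedSpace.inclusionInDoubleDual ℝ E)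

theorem coe_toWeakStarBidualCLM : ⇑(toWeakStarBidualCLM E) = toWeakStarBidual E := rfl

theorem toWeakStarBidual_injective : Function.Injective (toWeakStarBidual E) := fun _ _ h =>
  (SeparatingDual.eq_iff_forall_dual_eq (R := ℝ)).2 fun f => DFunLike.congr_fun h f

theorem isCompact_closure_toWeakStarBidual_closedBall :
    IsCompact (closure (toWeakStarBidual E '' Metric.closedBall 0 1)) := by
  refine (WeakDual.isCompact_closedBall (𝕜 := ℝ) (0 : StrongDual ℝ (StrongDual ℝ E)) 1
    ).closure_of_subset ?_
  rintro _ ⟨x, hx, rfl⟩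
  simp only [Metric.mem_closedBall, dist_zero_right] at hx
  simpa [toWeakStarBidual] using (NormedSpace.double_dual_bound ℝ E x).trans hx

theorem convex_closure_toWeakStarBidual_closedBall :
    Convex ℝ (closure (toWeakStarBidual E '' Metric.closedBall 0 1)) := by
  have h : Convex ℝ (toWeakStarBidual E '' Metric.closedBall 0 1) := by
    rintro _ ⟨x, hx, rfl⟩ _ ⟨y, hy, rfl⟩ a b ha hb hab
    refine ⟨a • x + b • y, convex_closedBall (0 : E) 1 hx hy ha hb hab, ?_⟩
    rw [← coe_toWeakStarBidualCLM, map_add, map_smul, map_smul]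
  have h' := Convex.closure (𝕜 := ℝ) (E := WeakDual ℝ (StrongDual ℝ E)) h
  exact h'

/-- Bounded ultrafilter limits exist in the bidual. -/
theorem exists_tendsto_dual_of_ultrafilter {α : Type*} (U : Ultrafilter α) {u : α → E}
    (hu : ∀ᶠ a in U, ‖u a‖ ≤ 1) :
    ∃ ξ : StrongDual ℝ (StrongDual ℝ E), ∀ f : StrongDual ℝ E,
      Tendsto (fun a => f (u a)) U (𝓝 (ξ f)) := by
  obtain ⟨ξ, -, hξ⟩ := isCompact_closure_toWeakStarBidual_closedBall.ultrafilter_le_nhds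
    (U.map (toWeakStarBidual E ∘ u)) (by
      rw [le_principal_iff, Ultrafilter.coe_map, Filter.mem_map]
      filter_upwards [hu] with a ha
      exact subset_closure ⟨u a, by simpa using ha, rfl⟩)
  refine ⟨WeakDual.toStrongDual ξ, fun f => ?_⟩
  exact ((WeakDual.eval_continuous f).tendsto ξ).comp hξ

theorem norm_le_one_of_tendsto_dual {α : Type*} {U : Filter α} [U.NeBot] {u : α → E}
    (hu : ∀ᶠ a in U, ‖u a‖ ≤ 1) {x : E}
    (hx : ∀ f : StrongDual ℝ E, Tendsto (fun a => f (u a)) U (𝓝 (f x))) : ‖x‖ ≤ 1 := by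
  refine NormedSpace.norm_le_dual_bound ℝ x zero_le_one fun f => ?_
  refine le_of_tendsto (hx f).norm ?_
  filter_upwards [hu] with a ha
  rw [one_mul]
  exact f.le_of_opNorm_le_of_le le_rfl ha |>.trans (by simp)

theorem IsPreservedExtremePoint.ne_zero [Nontrivial E] {z : E}
    (hz : IsPreservedExtremePoint (Metric.closedBall (0 : E) 1) z) : z ≠ 0 := by
  rintro rfl
  obtain ⟨w, hw⟩ := exists_norm_eq E zero_le_one
  have hmem : ∀ v : E, ‖v‖ = 1 →
      toWeakStarBidual E v ∈ closure (toWeakStarBidual E '' Metric.closedBall 0 1) :=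
    fun v hv => subset_closure ⟨v, by simp [hv], rfl⟩
  have h := hz.2.2 (hmem w hw) (hmem (-w) (by simpa using hw))
    ⟨1 / 2, 1 / 2, by norm_num, by norm_num, by norm_num, by
      simp only [← coe_toWeakStarBidualCLM, map_neg, map_zero, smul_neg, add_neg_cancel]⟩
  rw [toWeakStarBidual_injective h, norm_zero] at hw
  exact zero_ne_one hw

theorem image_subset_closure_convexHull {G : Type*} [AddCommMonoid G] [Module ℝ G]
    [TopologicalSpace G] (T : E →L[ℝ] G) {C S : Set E} (h : C ⊆ closure (convexHull ℝ S)) :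
    T '' C ⊆ closure (convexHull ℝ (T '' S)) :=
  (image_mono h).trans ((image_closure_subset_closure_image T.continuous).trans
    (closure_mono (T.toLinearMap.image_convexHull S).le))

/-- A preserved extreme point of the unit ball lies in the weak closure of any subset whose closed
convex hull is the ball. -/
theorem IsPreservedExtremePoint.mem_closure {S : Set E} (hS : S ⊆ Metric.closedBall 0 1)
    (hS' : Metric.closedBall 0 1 ⊆ closure (convexHull ℝ S)) {z : E}
    (hz : IsPreservedExtremePoint (Metric.closedBall (0 : E) 1) z) :
    toWeakStarBidual E z ∈ closure (toWeakStarBidual E '' S) := by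
  have : LocallyConvexSpace ℝ (WeakDual ℝ (StrongDual ℝ E)) :=
    (WeakDual.withSeminorms ℝ (StrongDual ℝ E)).toLocallyConvexSpace
  have hsub := closure_minimal
    (image_subset_closure_convexHull (toWeakStarBidualCLM E) hS') isClosed_closure
  have hS'' := (image_mono (f := toWeakStarBidual E) hS).trans subset_closure
  have hmilman := mem_closure_of_mem_extremePoints (E := WeakDual ℝ (StrongDual ℝ E))
    isCompact_closure_toWeakStarBidual_closedBall convex_closure_toWeakStarBidual_closedBall hS''
  have hmem := hmilman hsub (z := toWeakStarBidual E z)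
  have hmem' := hmem hz.2
  exact hmem'

/-- The transpose of the transpose, between the biduals with their weak-star topologies. -/
noncomputable def weakStarBidualMap (J : E →L[ℝ] F) :
    WeakDual ℝ (StrongDual ℝ E) →L[ℝ] WeakDual ℝ (StrongDual ℝ F) where
  toFun ξ := StrongDual.toWeakDual ((WeakDual.toStrongDual ξ).comp
    ((ContinuousLinearMap.compL ℝ E F ℝ).flip J))
  map_add' _ _ := rfl
  map_smul' _ _ := rfl
  cont := WeakDual.continuous_of_continuous_eval fun g =>
    WeakDual.eval_continuous (g.comp J)

/-- A point mapped to a preserved extreme point of the ball by a contraction whose transpose is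
onto is itself a preserved extreme point of the ball. -/
theorem IsPreservedExtremePoint.of_map {J : E →L[ℝ] F}
    (hJ : ∀ v : E, ‖v‖ ≤ 1 → ‖J v‖ ≤ 1)
    (hsurj : ∀ f : StrongDual ℝ E, ∃ g : StrongDual ℝ F, g.comp J = f) {x : E} (hx : ‖x‖ ≤ 1)
    (h : IsPreservedExtremePoint (Metric.closedBall (0 : F) 1) (J x)) :
    IsPreservedExtremePoint (Metric.closedBall (0 : E) 1) x := by
  have hinj : Function.Injective (weakStarBidualMap J) := fun ξ η hξη => by
    refine DFunLike.ext _ _ fun f => ?_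
    obtain ⟨g, rfl⟩ := hsurj f
    exact DFunLike.congr_fun hξη g
  have hmaps : MapsTo (weakStarBidualMap J)
      (closure (toWeakStarBidual E '' Metric.closedBall 0 1))
      (closure (toWeakStarBidual F '' Metric.closedBall 0 1)) := by
    refine MapsTo.closure ?_ (weakStarBidualMap J).continuous
    rintro _ ⟨v, hv, rfl⟩
    exact ⟨J v, by simpa using hJ v (by simpa using hv), rfl⟩
  refine ⟨by simpa using hx, subset_closure ⟨x, by simpa using hx, rfl⟩, ?_⟩
  intro ξ hξ η hη hseg
  refine hinj (h.2.2 (hmaps hξ) (hmaps hη) ?_)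
  obtain ⟨a, b, ha, hb, hab, hx'⟩ := hseg
  refine ⟨a, b, ha, hb, hab, ?_⟩
  rw [← map_smul, ← map_smul, ← map_add, hx']
  rfl

end WeakStarBidual

namespace ProjectiveTensorProduct

variable {X Y Z : Type*} [NormedAddCommGroup X] [NormedSpace ℝ X]
  [NormedAddCommGroup Y] [NormedSpace ℝ Y] [NormedAddCommGroup Z] [NormedSpace ℝ Z]

theorem coe_sum {n : ℕ} (x : Fin n → X) (y : Fin n → Y) :
    ((∑ i, Alg.mk X Y (x i) (y i) : Alg X Y) : ProjectiveTensorProduct X Y) =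
      ∑ i, tmul (x i) (y i) :=
  map_sum (UniformSpace.Completion.toComplL : Alg X Y →L[ℝ] ProjectiveTensorProduct X Y) _ _

theorem norm_tmul_le (x : X) (y : Y) : ‖tmul x y‖ ≤ ‖x‖ * ‖y‖ := by
  rw [tmul, UniformSpace.Completion.norm_coe]
  exact projNorm_le (reprSums_mk x y)

/-- The elementary tensors, as a continuous bilinear map. -/
noncomputable def tmulL (X Y : Type*) [NormedAddCommGroup X] [NormedSpace ℝ X]
    [NormedAddCommGroup Y] [NormedSpace ℝ Y] : X →L[ℝ] Y →L[ℝ] ProjectiveTensorProduct X Y :=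
  ((Alg.mk X Y).compr₂
    (UniformSpace.Completion.toComplL : Alg X Y →L[ℝ] ProjectiveTensorProduct X Y).toLinearMap
    ).mkContinuous₂ 1 fun x y => by
      rw [one_mul]
      exact norm_tmul_le x y

theorem tmulL_apply (x : X) (y : Y) : tmulL X Y x y = tmul x y := rfl

theorem clm_ext {φ ψ : ProjectiveTensorProduct X Y →L[ℝ] Z}
    (h : ∀ x y, φ (tmul x y) = ψ (tmul x y)) : φ = ψ := by
  refine DFunLike.ext _ _ fun z => ?_
  refine UniformSpace.Completion.induction_on z (isClosed_eq φ.continuous ψ.continuous) fun a => ?_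
  obtain ⟨-, n, x, y, rfl, -⟩ := reprSums_nonempty a
  simp only [coe_sum, map_sum, h]

theorem functional_eq_of_tmul {T : X →L[ℝ] StrongDual ℝ Y}
    {φ : StrongDual ℝ (ProjectiveTensorProduct X Y)} (h : ∀ x y, T x y = φ (tmul x y)) :
    functional T = φ :=
  clm_ext fun x y => (functional_tmul T x y).trans (h x y)

theorem exists_functional_eq (φ : StrongDual ℝ (ProjectiveTensorProduct X Y)) :
    ∃ T : X →L[ℝ] StrongDual ℝ Y, functional T = φ :=
  ⟨(ContinuousLinearMap.compL ℝ Y _ ℝ φ).comp (tmulL X Y), functional_eq_of_tmul fun _ _ => rfl⟩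

theorem norm_functional_le (T : X →L[ℝ] StrongDual ℝ Y) : ‖functional T‖ ≤ ‖T‖ := by
  refine ContinuousLinearMap.opNorm_le_bound _ (norm_nonneg T) fun z => ?_
  refine UniformSpace.Completion.induction_on z
    (isClosed_le (functional T).continuous.norm (continuous_const.mul continuous_norm)) fun a => ?_
  rw [UniformSpace.Completion.norm_coe]
  refine le_trans (le_of_eq ?_) (norm_algFunctional_le T a)
  obtain ⟨-, n, x, y, rfl, -⟩ := reprSums_nonempty a
  simp only [coe_sum, map_sum, functional_tmul, algFunctional_mk]

/-- The closed unit ball is the closed convex hull of the elementary tensors in it. -/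
theorem closedBall_subset_closure_convexHull :
    Metric.closedBall (0 : ProjectiveTensorProduct X Y) 1 ⊆ closure (convexHull ℝ
      ((fun p : X × Y => tmul p.1 p.2) '' (Metric.closedBall 0 1 ×ˢ Metric.closedBall 0 1))) := by
  intro w hw
  by_contra hwS
  obtain ⟨φ, u, hu, huw⟩ := geometric_hahn_banach_closed_point
    (convex_convexHull ℝ _).closure isClosed_closure hwS
  obtain ⟨T, rfl⟩ := exists_functional_eq φ
  have hT : ∀ x y, ‖x‖ ≤ 1 → ‖y‖ ≤ 1 → T x y ≤ u := fun x y hx hy => by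
    rw [← functional_tmul]
    exact (hu _ (subset_closure (subset_convexHull ℝ _
      ⟨(x, y), ⟨by simpa using hx, by simpa using hy⟩, rfl⟩))).le
  have hu0 : 0 ≤ u := by simpa using hT 0 0 (by simp) (by simp)
  have hTu : ‖T‖ ≤ u := by
    refine ContinuousLinearMap.opNorm_le_of_unit_norm hu0 fun x hx => ?_
    refine ContinuousLinearMap.opNorm_le_of_unit_norm hu0 fun y hy => ?_
    refine abs_le.2 ⟨?_, hT x y hx.le hy.le⟩
    have := hT (-x) y (by simp [hx]) hy.le
    simp only [map_neg, neg_apply] at this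
    linarith
  have hw1 : ‖w‖ ≤ 1 := by simpa using hw
  have := (le_abs_self _).trans ((functional T).le_of_opNorm_le_of_le
    ((norm_functional_le T).trans hTu) hw1)
  linarith

/-- A continuous bilinear map into a Banach space factors through the projective tensor product. -/
theorem exists_clm_of_bilinear [CompleteSpace Z] (B : X →L[ℝ] Y →L[ℝ] Z) :
    ∃ L : ProjectiveTensorProduct X Y →L[ℝ] Z, ∀ x y, L (tmul x y) = B x y := by
  let L₀ : Alg X Y →ₗ[ℝ] Z := TensorProduct.lift (R := ℝ) (M := X) (N := Y)
    ((ContinuousLinearMap.coeLM ℝ).comp B.toLinearMap)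
  have hL₀ : ∀ x y, L₀ (Alg.mk X Y x y) = B x y := fun x y => TensorProduct.lift.tmul x y
  have hb : ∀ z, ‖L₀ z‖ ≤ ‖B‖ * ‖z‖ := fun z => by
    rw [norm_def, projNorm, ← smul_eq_mul, ← Real.sInf_smul_of_nonneg (norm_nonneg B)]
    refine le_csInf ((reprSums_nonempty z).smul_set) ?_
    rintro _ ⟨_, ⟨n, x, y, rfl, rfl⟩, rfl⟩
    simp only [map_sum, hL₀, smul_eq_mul, Finset.mul_sum]
    refine (norm_sum_le _ _).trans (Finset.sum_le_sum fun i _ => ?_)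
    rw [← mul_assoc]
    exact B.le_opNorm₂ (x i) (y i)
  refine ⟨(L₀.mkContinuous ‖B‖ hb).extend
    (UniformSpace.Completion.toComplL : Alg X Y →L[ℝ] UniformSpace.Completion (Alg X Y)),
    fun x y => ?_⟩
  refine (ContinuousLinearMap.extend_eq _ ?_ ?_ _).trans (hL₀ x y)
  · exact UniformSpace.Completion.denseRange_coe
  · exact UniformSpace.Completion.isUniformInducing_coe _

theorem exists_forall_apply_eq_functional_right [CompleteSpace Y] (f : StrongDual ℝ X)
    (z : ProjectiveTensorProduct X Y) :
    ∃ y : Y, ∀ g : StrongDual ℝ Y, g y = functional (f.smulRight g) z := by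
  obtain ⟨L, hL⟩ := exists_clm_of_bilinear (f.smulRight (ContinuousLinearMap.id ℝ Y))
  refine ⟨L z, fun g => ?_⟩
  rw [functional_eq_of_tmul (T := f.smulRight g) (φ := g.comp L) fun x y => by simp [hL]]
  rfl

theorem exists_forall_apply_eq_functional_left [CompleteSpace X] (g : StrongDual ℝ Y)
    (z : ProjectiveTensorProduct X Y) :
    ∃ x : X, ∀ f : StrongDual ℝ X, f x = functional (f.smulRight g) z := by
  obtain ⟨L, hL⟩ := exists_clm_of_bilinear (ContinuousLinearMap.smulRightL ℝ Y X g)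
  refine ⟨L z, fun f => ?_⟩
  rw [functional_eq_of_tmul (T := f.smulRight g) (φ := f.comp L) fun x y => by
    simp [hL, mul_comm]]
  rfl

end ProjectiveTensorProduct

namespace ProjectiveTensorProduct

variable {X Y : Type*} [NormedAddCommGroup X] [NormedSpace ℝ X]
  [NormedAddCommGroup Y] [NormedSpace ℝ Y]

theorem functional_sub (T S : X →L[ℝ] StrongDual ℝ Y) :
    functional (T - S) = functional T - functional S :=
  functional_eq_of_tmul fun x y => by simp [functional_tmul]

theorem eq_of_compactOperatorsSeparate (h : CompactOperatorsSeparate X Y)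
    {z w : ProjectiveTensorProduct X Y}
    (hzw : ∀ K : X →L[ℝ] StrongDual ℝ Y, IsCompactOperator K → functional K z = functional K w) :
    z = w := by
  by_contra hne
  obtain ⟨_, ⟨K, hK, rfl⟩, hKne⟩ := h hne
  exact hKne (hzw K hK)

/-- Under the separation hypothesis, nonzero weak limits of elementary tensors in the unit ball are
elementary. -/
theorem exists_eq_tmul_of_tendsto [CompleteSpace X] [CompleteSpace Y]
    (h : CompactOperatorsSeparate X Y) {z : ProjectiveTensorProduct X Y} (hz : z ≠ 0)
    (U : Ultrafilter (X × Y)) (hU₁ : ∀ᶠ p : X × Y in U, ‖p.1‖ ≤ 1)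
    (hU₂ : ∀ᶠ p : X × Y in U, ‖p.2‖ ≤ 1)
    (hU : ∀ φ : StrongDual ℝ (ProjectiveTensorProduct X Y),
      Tendsto (fun p : X × Y => φ (tmul p.1 p.2)) U (𝓝 (φ z))) :
    ∃ x y, ‖x‖ ≤ 1 ∧ ‖y‖ ≤ 1 ∧ z = tmul x y := by
  obtain ⟨ξ, hξ⟩ := exists_tendsto_dual_of_ultrafilter U hU₁
  obtain ⟨η, hη⟩ := exists_tendsto_dual_of_ultrafilter U hU₂
  have hprod : ∀ (f : StrongDual ℝ X) (g : StrongDual ℝ Y),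
      functional (f.smulRight g) z = ξ f * η g := fun f g => by
    refine tendsto_nhds_unique (hU _) (((hξ f).mul (hη g)).congr fun p => ?_)
    simp [functional_tmul]
  have hcompact : ∀ K : X →L[ℝ] StrongDual ℝ Y, IsCompactOperator K →
      ∃ k : StrongDual ℝ Y, (∀ y, k y = ξ (K.flip y)) ∧ functional K z = η k := by
    intro K hK
    obtain ⟨C, hC, hKC⟩ := hK.image_closedBall_subset_compact (f := K.toLinearMap) 1
    obtain ⟨k, -, hk⟩ := hC.ultrafilter_le_nhds (U.map fun p => K p.1) (by
      rw [le_principal_iff, Ultrafilter.coe_map, Filter.mem_map]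
      filter_upwards [hU₁] with p hp
      exact hKC ⟨p.1, by simpa using hp, rfl⟩)
    have hk : Tendsto (fun p : X × Y => K p.1) U (𝓝 k) := hk
    refine ⟨k, fun y => ?_, ?_⟩
    · exact tendsto_nhds_unique
        (((ContinuousLinearMap.apply ℝ ℝ y).continuous.tendsto k).comp hk) (hξ (K.flip y))
    · refine tendsto_nhds_unique (hU _) ?_
      have h0 : Tendsto (fun p : X × Y => (K p.1 - k) p.2) U (𝓝 0) := by
        refine squeeze_zero_norm' ?_ (tendsto_iff_norm_sub_tendsto_zero.1 hk)
        filter_upwards [hU₂] with p hp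
        simpa using (K p.1 - k).le_of_opNorm_le_of_le le_rfl hp
      simpa [functional_tmul] using h0.add (hη k)
  have hξ0 : ξ ≠ 0 := by
    rintro rfl
    refine hz (eq_of_compactOperatorsSeparate h fun K hK => ?_)
    obtain ⟨k, hk, hkz⟩ := hcompact K hK
    have : k = 0 := by ext y; simpa using hk y
    rw [hkz, this, map_zero, map_zero]
  have hη0 : η ≠ 0 := by
    rintro rfl
    refine hz (eq_of_compactOperatorsSeparate h fun K hK => ?_)
    obtain ⟨k, -, hkz⟩ := hcompact K hK
    rw [hkz, map_zero]
    rfl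
  obtain ⟨f₀, hf₀⟩ := DFunLike.exists_ne hξ0
  obtain ⟨g₀, hg₀⟩ := DFunLike.exists_ne hη0
  simp only [zero_apply] at hf₀ hg₀
  obtain ⟨y₀, hy₀⟩ := exists_forall_apply_eq_functional_right f₀ z
  obtain ⟨x₀, hx₀⟩ := exists_forall_apply_eq_functional_left g₀ z
  have hx : ∀ f : StrongDual ℝ X, ξ f = f ((η g₀)⁻¹ • x₀) := fun f => by
    rw [map_smul, hx₀, hprod, smul_eq_mul]
    field_simp
  have hy : ∀ g : StrongDual ℝ Y, η g = g ((ξ f₀)⁻¹ • y₀) := fun g => by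
    rw [map_smul, hy₀, hprod, smul_eq_mul]
    field_simp
  refine ⟨_, _, norm_le_one_of_tendsto_dual hU₁ fun f => hx f ▸ hξ f,
    norm_le_one_of_tendsto_dual hU₂ fun g => hy g ▸ hη g,
    eq_of_compactOperatorsSeparate h fun K hK => ?_⟩
  obtain ⟨k, hk, hkz⟩ := hcompact K hK
  rw [hkz, hy, hk, hx, functional_tmul, ContinuousLinearMap.flip_apply]

theorem exists_ultrafilter_of_isPreservedExtremePoint {z : ProjectiveTensorProduct X Y}
    (hz : IsPreservedExtremePoint (Metric.closedBall (0 : ProjectiveTensorProduct X Y) 1) z) :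
    ∃ U : Ultrafilter (X × Y), (∀ᶠ p : X × Y in U, ‖p.1‖ ≤ 1) ∧ (∀ᶠ p : X × Y in U, ‖p.2‖ ≤ 1) ∧
      ∀ φ : StrongDual ℝ (ProjectiveTensorProduct X Y),
        Tendsto (fun p : X × Y => φ (tmul p.1 p.2)) U (𝓝 (φ z)) := by
  set D : Set (X × Y) := Metric.closedBall 0 1 ×ˢ Metric.closedBall 0 1
  set t : X × Y → ProjectiveTensorProduct X Y := fun p => tmul p.1 p.2
  have hDP : t '' D ⊆ Metric.closedBall 0 1 := by
    rintro _ ⟨p, ⟨hp₁, hp₂⟩, rfl⟩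
    simp only [Metric.mem_closedBall, dist_zero_right] at hp₁ hp₂ ⊢
    exact (norm_tmul_le _ _).trans (mul_le_one₀ hp₁ (norm_nonneg _) hp₂)
  have hmem := hz.mem_closure hDP closedBall_subset_closure_convexHull
  rw [image_image, mem_closure_iff_clusterPt, ← map_principal] at hmem
  obtain ⟨U, hUD, hU⟩ := mapClusterPt_iff_ultrafilter.1 hmem
  rw [le_principal_iff] at hUD
  refine ⟨U, ?_, ?_, fun φ => ((WeakDual.eval_continuous φ).tendsto _).comp hU⟩
  · filter_upwards [hUD] with p hp
    simpa using hp.1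
  · filter_upwards [hUD] with p hp
    simpa using hp.2

theorem functional_smulRight_comp_tmulL_flip (f : StrongDual ℝ X) {g : StrongDual ℝ Y} {y : Y}
    (hg : g y = 1) : (functional (f.smulRight g)).comp ((tmulL X Y).flip y) = f := by
  ext x
  simp [tmulL_apply, functional_tmul, hg]

theorem functional_smulRight_comp_tmulL {f : StrongDual ℝ X} (g : StrongDual ℝ Y) {x : X}
    (hf : f x = 1) : (functional (f.smulRight g)).comp (tmulL X Y x) = g := by
  ext y
  simp [tmulL_apply, functional_tmul, hf]

theorem isPreservedExtremePoint_of_tmul {x : X} {y : Y} (hx : ‖x‖ ≤ 1) (hy : ‖y‖ ≤ 1)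
    (hne : tmul x y ≠ 0)
    (h : IsPreservedExtremePoint (Metric.closedBall (0 : ProjectiveTensorProduct X Y) 1)
      (tmul x y)) :
    IsPreservedExtremePoint (Metric.closedBall (0 : X) 1) x ∧
      IsPreservedExtremePoint (Metric.closedBall (0 : Y) 1) y := by
  have hx0 : x ≠ 0 := by
    rintro rfl
    exact hne (by rw [← tmulL_apply, map_zero, zero_apply])
  have hy0 : y ≠ 0 := by
    rintro rfl
    exact hne (by rw [← tmulL_apply, map_zero])
  obtain ⟨f, hf⟩ := SeparatingDual.exists_eq_one (R := ℝ) hx0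
  obtain ⟨g, hg⟩ := SeparatingDual.exists_eq_one (R := ℝ) hy0
  constructor
  · exact h.of_map (J := (tmulL X Y).flip y)
      (fun v hv => (norm_tmul_le v y).trans (mul_le_one₀ hv (norm_nonneg _) hy))
      (fun f => ⟨_, functional_smulRight_comp_tmulL_flip f hg⟩) hx
  · exact h.of_map (J := tmulL X Y x)
      (fun v hv => (norm_tmul_le x v).trans (mul_le_one₀ hx (norm_nonneg _) hv))
      (fun g => ⟨_, functional_smulRight_comp_tmulL g hf⟩) hy

protected theorem nontrivial [Nontrivial X] [Nontrivial Y] :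
    Nontrivial (ProjectiveTensorProduct X Y) := by
  obtain ⟨x, hx⟩ := exists_ne (0 : X)
  obtain ⟨y, hy⟩ := exists_ne (0 : Y)
  obtain ⟨f, hf⟩ := SeparatingDual.exists_eq_one (R := ℝ) hx
  obtain ⟨g, hg⟩ := SeparatingDual.exists_eq_one (R := ℝ) hy
  refine ⟨tmul x y, 0, fun h => ?_⟩
  have := functional_tmul (f.smulRight g) x y
  simp [h, hf, hg] at this

theorem exists_repr_of_norm_lt {a : Alg X Y} {r s : ℝ} (hs : 0 < s) (ha : ‖a‖ < r) :
    ∃ (n : ℕ) (x : Fin n → X) (y : Fin n → Y), a = ∑ i, Alg.mk X Y (x i) (y i) ∧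
      (∀ i, ‖x i‖ ≤ s) ∧ ∑ i, ‖y i‖ ≤ r / s := by
  obtain ⟨_, ⟨n, x, y, rfl, rfl⟩, hr⟩ := exists_lt_of_csInf_lt (reprSums_nonempty a) ha
  refine ⟨n, fun i => (s / ‖x i‖) • x i, fun i => (‖x i‖ / s) • y i, ?_, fun i => ?_, ?_⟩
  · refine Finset.sum_congr rfl fun i _ => ?_
    rcases eq_or_ne (x i) 0 with h | h
    · simp [h]
    · have := norm_ne_zero_iff.2 h
      rw [map_smul, map_smul, LinearMap.smul_apply, smul_smul, div_mul_div_cancel₀ hs.ne',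
        div_self this, one_smul]
  · rcases eq_or_ne (x i) 0 with h | h
    · simp [h, hs.le]
    · have := norm_ne_zero_iff.2 h
      rw [norm_smul, norm_div, norm_norm, div_mul_cancel₀ _ this, Real.norm_of_nonneg hs.le]
  · refine le_of_eq_of_le ?_ (div_le_div_of_nonneg_right hr.le hs.le)
    rw [Finset.sum_div]
    refine Finset.sum_congr rfl fun i _ => ?_
    rw [norm_smul, norm_div, norm_norm, Real.norm_of_nonneg hs.le, div_mul_eq_mul_div]

/-- On operators, the evaluation at an element of the projective tensor product is controlled by
the values on a compact set. -/
theorem exists_isCompact_norm_functional_le [CompleteSpace X] (z : ProjectiveTensorProduct X Y) :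
    ∃ (A : Set X) (C : ℝ), IsCompact A ∧ ∀ (T : X →L[ℝ] StrongDual ℝ Y) (ε : ℝ), 0 ≤ ε →
      (∀ a ∈ A, ‖T a‖ ≤ ε) → ‖functional T z‖ ≤ ε * C := by
  have hz : z ∈ closure ((UniformSpace.Completion.toComplL :
      Alg X Y →L[ℝ] ProjectiveTensorProduct X Y).toLinearMap.toAddMonoidHom.range :
        Set (ProjectiveTensorProduct X Y)) :=
    UniformSpace.Completion.denseRange_coe z
  obtain ⟨v, hv, hvmem, -, hvn⟩ := controlled_sum_of_mem_closure hz
    (b := fun n => (1 / 4 : ℝ) ^ n) fun n => by positivity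
  choose a ha using hvmem
  replace ha : ∀ n, ((a n : Alg X Y) : ProjectiveTensorProduct X Y) = v n := ha
  set M : ℝ := ‖a 0‖ + 1 with hM
  have hM1 : 1 ≤ M := by linarith [norm_nonneg (a 0)]
  have han : ∀ n, ‖a n‖ < M * (1 / 4) ^ n := fun n => by
    rcases n.eq_zero_or_pos with rfl | hn
    · simp [hM]
    · have := hvn n hn
      rw [← ha, UniformSpace.Completion.norm_coe] at this
      exact this.trans_le (le_mul_of_one_le_left (by positivity) hM1)
  choose N x y hxy hx hy using fun n =>
    exists_repr_of_norm_lt (s := (1 / 2 : ℝ) ^ n) (by positivity) (han n)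
  have hy' : ∀ n, ∑ i, ‖y n i‖ ≤ M * (1 / 2) ^ n := fun n => by
    refine (hy n).trans_eq ?_
    rw [mul_div_assoc, ← div_pow]
    norm_num
  set A₀ : Set X := ⋃ n, range (x n)
  have htb : TotallyBounded A₀ := by
    refine Metric.totallyBounded_iff.2 fun ε hε => ?_
    obtain ⟨m, hm⟩ := exists_pow_lt_of_lt_one hε (by norm_num : (1 / 2 : ℝ) < 1)
    refine ⟨insert 0 (⋃ n ∈ Iio m, range (x n)),
      ((finite_Iio m).biUnion fun n _ => finite_range (x n)).insert 0, ?_⟩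
    refine iUnion_subset fun n => ?_
    rintro _ ⟨i, rfl⟩
    rcases lt_or_ge n m with h | h
    · exact mem_biUnion (mem_insert_of_mem _ (mem_biUnion h ⟨i, rfl⟩)) (Metric.mem_ball_self hε)
    · refine mem_biUnion (mem_insert _ _) ?_
      rw [mem_ball_zero_iff]
      exact ((hx n i).trans (pow_le_pow_of_le_one (by norm_num) (by norm_num) h)).trans_lt hm
  refine ⟨closure A₀, M * 2, htb.closure.isCompact_of_isClosed isClosed_closure,
    fun T ε hε hT => ?_⟩
  have hvT : ∀ n, ‖functional T (v n)‖ ≤ ε * M * (1 / 2) ^ n := fun n => by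
    rw [← ha, hxy, coe_sum, map_sum]
    calc ‖∑ i, functional T (tmul (x n i) (y n i))‖ ≤ ∑ i, ε * ‖y n i‖ := by
          refine norm_sum_le_of_le _ fun i _ => ?_
          rw [functional_tmul]
          exact (T (x n i)).le_of_opNorm_le
            (hT _ (subset_closure (mem_iUnion.2 ⟨n, i, rfl⟩))) _
      _ ≤ ε * (M * (1 / 2) ^ n) := by
          rw [← Finset.mul_sum]
          exact mul_le_mul_of_nonneg_left (hy' n) hε
      _ = ε * M * (1 / 2) ^ n := by ring
  refine le_of_tendsto (((functional T).continuous.tendsto z).comp hv).norm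
    (Eventually.of_forall fun n => ?_)
  rw [Function.comp_apply, map_sum]
  refine (norm_sum_le_of_le _ fun i _ => hvT i).trans ?_
  rw [← Finset.mul_sum, ← mul_assoc]
  exact mul_le_mul_of_nonneg_left (sum_geometric_two_le _) (by positivity)

end ProjectiveTensorProduct

open ProjectiveTensorProduct

theorem HasCompactApproximationProperty.exists_forall_norm_sub_lt {X Z : Type*}
    [NormedAddCommGroup X] [NormedSpace ℝ X] [NormedAddCommGroup Z] [NormedSpace ℝ Z]
    (h : HasCompactApproximationProperty X Z) (T : X →L[ℝ] Z) {A : Set X} (hA : IsCompact A)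
    {ε : ℝ} (hε : 0 < ε) :
    ∃ K : X →L[ℝ] Z, IsCompactOperator K ∧ ∀ a ∈ A, ‖T a - K a‖ < ε := by
  set T' := UniformConvergenceCLM.ofFun (RingHom.id ℝ) Z {S : Set X | IsCompact S} T
  have hT := h.ge (mem_univ T')
  rw [mem_closure_iff_frequently] at hT
  have := (UniformConvergenceCLM.tendsto_iff_tendstoUniformlyOn (RingHom.id ℝ) Z
    {S : Set X | IsCompact S}).1 (tendsto_id (x := 𝓝 T')) A hA
  obtain ⟨K, hK, hKA⟩ := (hT.and_eventually (Metric.tendstoUniformlyOn_iff.1 this ε hε)).exists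
  exact ⟨K, hK, fun a ha => by
    rw [← dist_eq_norm]
    exact hKA a ha⟩

theorem HasCompactApproximationProperty.compactOperatorsSeparate {X Y : Type*}
    [NormedAddCommGroup X] [NormedSpace ℝ X] [CompleteSpace X]
    [NormedAddCommGroup Y] [NormedSpace ℝ Y]
    (h : HasCompactApproximationProperty X (StrongDual ℝ Y)) : CompactOperatorsSeparate X Y := by
  intro z w hzw
  by_contra! hK
  refine hzw (sub_eq_zero.1 ((SeparatingDual.eq_zero_iff_forall_dual_eq_zero (R := ℝ) _).2
    fun φ => ?_))
  obtain ⟨T, rfl⟩ := exists_functional_eq φ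
  obtain ⟨A, C, hA, hAC⟩ := exists_isCompact_norm_functional_le (z - w)
  have hbound : ∀ ε : ℝ, 0 < ε → ‖functional T (z - w)‖ ≤ ε * C := fun ε hε => by
    obtain ⟨K, hKc, hKT⟩ := h.exists_forall_norm_sub_lt T hA hε
    have hK0 : functional K (z - w) = 0 := by
      rw [map_sub, sub_eq_zero]
      exact hK _ ⟨K, hKc, rfl⟩
    have := hAC (T - K) ε hε.le fun a ha => (hKT a ha).le
    rwa [functional_sub, sub_apply, hK0, sub_zero] at this
  refine norm_le_zero_iff.1 (ge_of_tendsto (x := 𝓝[>] (0 : ℝ)) (f := fun ε => ε * C) ?_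
    (eventually_mem_nhdsWithin.mono hbound))
  exact ((continuous_mul_const C).tendsto' 0 0 (zero_mul C)).mono_left nhdsWithin_le_nhds

theorem mainTheorem2 {X Y : Type*}
    [NormedAddCommGroup X] [NormedSpace ℝ X] [CompleteSpace X] [Nontrivial X]
    [NormedAddCommGroup Y] [NormedSpace ℝ Y] [CompleteSpace Y] [Nontrivial Y] :
    (HasCompactApproximationProperty X (StrongDual ℝ Y) → CompactOperatorsSeparate X Y) ∧
    (CompactOperatorsSeparate X Y →
      ∀ z : ProjectiveTensorProduct X Y,
        IsPreservedExtremePoint (Metric.closedBall (0 : ProjectiveTensorProduct X Y) 1) z →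
        ∃ (x : X) (y : Y), z = ProjectiveTensorProduct.tmul x y ∧
          IsPreservedExtremePoint (Metric.closedBall (0 : X) 1) x ∧
          IsPreservedExtremePoint (Metric.closedBall (0 : Y) 1) y) := by
  refine ⟨fun h => h.compactOperatorsSeparate, fun h z hz => ?_⟩
  have : Nontrivial (ProjectiveTensorProduct X Y) := ProjectiveTensorProduct.nontrivial
  obtain ⟨U, hU₁, hU₂, hU⟩ := exists_ultrafilter_of_isPreservedExtremePoint hz
  obtain ⟨x, y, hx, hy, rfl⟩ := exists_eq_tmul_of_tendsto h hz.ne_zero U hU₁ hU₂ hU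
  exact ⟨x, y, rfl, isPreservedExtremePoint_of_tmul hx hy hz.ne_zero hz⟩
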